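/- A sequence of non-negative integers $(h_1,h_2,\dots,h_k)$, $k\ge 1$, is called a pure $O$-sequence if $h_k>0$ and there exist monomials $m_1,\dots,m_{h_k}$ of degree $k$ in variables $x_1,\dots,x_{h_1}$ of degree one such that, for $1\le l\le k$, $h_l$ is the number of monomials of degree $l$ in $x_1,\dots,x_{h_1}$ that divide $m_i$ for some $1\le i\le h_k$. Put $h_0=1$ and $g_i=h_i-h_{i-1}$ for $1\le i\le k$. Theorem. Let $(h_1,\dots,h_k)$ be a pure $O$-sequence. Then (a) $h_i\le h_j$ whenever $0\le i\le j\le k-i$; (b) the $g$-inequalities hold, that is, $g_i\ge 0$ for $1\le i\le\lfloor k/2\rfloor$, and for every $1\le i<\lfloor k/2\rfloor$: if one writes $$g_i=\binom{n_i}{i}+\binom{n_{i-1}}{i-1}+\dots+\binom{n_r}{r},\qquad n_i>n_{i-1}>\dots>n_r\ge r\ge 1,$$ (the empty sum if $g_i=0$), then $$g_{i+1}\le\binom{n_i+1}{i+1}+\binom{n_{i-1}+1}{i}+\dots+\binom{n_r+1}{r+1}$$ (so $g_{i+1}\le 0$ if $g_i=0$). -/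

import Mathlib

/-- A sequence `h_1, …, h_k` (given by the values `h 1, …, h k`, with the usual convention
`h 0 = 1`) is a *pure O-sequence* if `k ≥ 1`, `h_k > 0`, and there are `h_k` monomials
`m_1, …, m_{h_k}` of degree `k` in the variables `x_1, …, x_{h_1}` such that, for `1 ≤ l ≤ k`,
`h_l` is the number of monomials of degree `l` in these variables that divide some `m_i`.
A monomial is represented by its exponent vector, so that divisibility is `≤`. -/
def IsPureOSequence (k : ℕ) (h : ℕ → ℕ) : Prop :=
  1 ≤ k ∧ h 0 = 1 ∧ 0 < h k ∧
    ∃ m : Fin (h k) → (Fin (h 1) →₀ ℕ),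
      (∀ i, (m i).degree = k) ∧
      ∀ l, 1 ≤ l → l ≤ k →
        h l = Set.ncard {s : Fin (h 1) →₀ ℕ | s.degree = l ∧ ∃ i, s ≤ m i}

/-- The differences `g_i = h_i - h_{i-1}`, as integers (used for `i ≥ 1` only). -/
def gNumber (h : ℕ → ℕ) (i : ℕ) : ℤ := (h i : ℤ) - (h (i - 1) : ℤ)

/-- `a = C(n_i, i) + C(n_{i-1}, i-1) + ⋯ + C(n_r, r)` with `n_i > n_{i-1} > ⋯ > n_r ≥ r ≥ 1`.
For `r > i` the sum is empty: this is the expansion of `a = 0`. -/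
def IsMacaulayExpansion (a : ℤ) (i r : ℕ) (n : ℕ → ℕ) : Prop :=
  1 ≤ r ∧ (r ≤ i → r ≤ n r) ∧ StrictMonoOn n (Set.Icc r i) ∧
    a = ∑ j ∈ Finset.Icc r i, ((n j).choose j : ℤ)

/-- The `g`-inequalities for `h_0, h_1, …, h_k`. -/
def SatisfiesGInequalities (k : ℕ) (h : ℕ → ℕ) : Prop :=
  (∀ i, 1 ≤ i → i ≤ k / 2 → 0 ≤ gNumber h i) ∧
  ∀ i, 1 ≤ i → i < k / 2 → ∀ (r : ℕ) (n : ℕ → ℕ),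
    IsMacaulayExpansion (gNumber h i) i r n →
      gNumber h (i + 1) ≤ ∑ j ∈ Finset.Icc r i, ((n j + 1).choose (j + 1) : ℤ)

/-! Let ℓ be the sum of the variables, acting by multiplication on the monomial algebra A whose
basis consists of the divisors of the `m i`; h is its Hilbert function. For a single monomial m one
gets a monomial complete intersection, which is an `sl₂`-module, so ℓ^p is injective on degree l
when 2l + p ≤ deg m (`vanishes_of_raiseOp_pow_vanishes`). An element of A killed by ℓ^p is killed on
the divisors of each `m i`, and every `m i` has degree k. Purity thus gives injectivity on A, hence
(a).

For p = 1, g_{l+1} is the dimension of the cokernel of ℓ, equivalently of the kernel of its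
transpose: the inverse system of A/ℓA in degree l + 1 (`finrank_inverseSystem_add`). Contraction by
a variable preserves this system, so the lex-initial monomials of its elements form a multicomplex
with the same counts (`sub_single_mem_initialPositions`, `card_initialPositions`). Macaulay's
theorem (`card_le_of_macaulayRep`), proved by two-variable compression and a splitting of Macaulay
expansions, bounds its growth. -/

/-- `MacaulayRep d n a b`: `a` has a `d`-th Macaulay expansion with all upper entries below `n`, and
`b` is obtained from it by raising all upper and lower entries by one. -/
inductive MacaulayRep : ℕ → ℕ → ℕ → ℕ → Prop
  | zero (d n : ℕ) : MacaulayRep d n 0 0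
  | cons {d n m a b : ℕ} (hm : d + 1 ≤ m) (hn : m < n) (h : MacaulayRep d m a b) :
      MacaulayRep (d + 1) n (m.choose (d + 1) + a) ((m + 1).choose (d + 2) + b)

/-! ### Arithmetic of Macaulay expansions. -/

namespace MacaulayRep

theorem mono {d n n' a b : ℕ} (h : MacaulayRep d n a b) (hn : n ≤ n') :
    MacaulayRep d n' a b := by
  cases h with
  | zero => exact .zero _ _
  | cons hm hlt h => exact .cons hm (hlt.trans_le hn) h

theorem eq_zero_of_le {d n a b : ℕ} (h : MacaulayRep d n a b) (hn : n ≤ d) : a = 0 ∧ b = 0 := by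
  cases h with
  | zero => exact ⟨rfl, rfl⟩
  | cons hm hlt h => omega

theorem eq_zero {d n b : ℕ} (h : MacaulayRep d n 0 b) : b = 0 := by
  generalize ha : 0 = a at h
  cases h with
  | zero => rfl
  | cons hm hlt h =>
    have := Nat.choose_pos hm
    omega

/-- Iterating Pascal's rule on the lower summand gives C(m, d+1) - 1 = C(m-1, d+1) + C(m-2, d) + ⋯.
-/
theorem exists_choose_sub_one (d m : ℕ) (hm : d + 1 ≤ m) :
    ∃ b, MacaulayRep (d + 1) m (m.choose (d + 1) - 1) b ∧ b < (m + 1).choose (d + 2) := by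
  induction d generalizing m with
  | zero =>
    rcases Nat.eq_or_lt_of_le hm with rfl | h
    · exact ⟨0, by simpa using MacaulayRep.zero 1 1, by simp⟩
    · obtain ⟨m, rfl⟩ : ∃ k, m = k + 1 := ⟨m - 1, by omega⟩
      have hrep := MacaulayRep.cons (d := 0) (n := m + 1) (m := m) (by omega) (by omega) (.zero 0 m)
      refine ⟨_, by simpa using hrep, ?_⟩
      have : (m + 1 + 1).choose 2 = (m + 1).choose 1 + (m + 1).choose 2 := Nat.choose_succ_succ _ _
      simp only [Nat.choose_one_right, Nat.zero_add, add_zero] at *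
      omega
  | succ d ih =>
    rcases Nat.eq_or_lt_of_le hm with rfl | h
    · exact ⟨0, by simpa using MacaulayRep.zero _ _, by simp⟩
    · obtain ⟨m, rfl⟩ : ∃ k, m = k + 1 := ⟨m - 1, by omega⟩
      obtain ⟨b, hb, hlt⟩ := ih m (by omega)
      have hpos : 0 < m.choose (d + 1) := Nat.choose_pos (by omega)
      have e1 := Nat.choose_succ_succ m (d + 1)
      have e2 := Nat.choose_succ_succ (m + 1) (d + 2)
      simp only [Nat.succ_eq_add_one, add_assoc, Nat.reduceAdd] at e1 e2
      refine ⟨(m + 1).choose (d + 1 + 1 + 1) + b, ?_, ?_⟩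
      · have := MacaulayRep.cons (n := m + 1) (m := m) (by omega) (by omega) hb
        convert this using 1
        simp only [add_assoc, Nat.reduceAdd]
        omega
      · simp only [add_assoc, Nat.reduceAdd] at *
        omega

/-- Strict monotonicity of a ↦ b: the last term of the expansion is the one to be decreased. -/
theorem exists_sub_one {d n a b : ℕ} (h : MacaulayRep d n a b) (ha : 0 < a) :
    ∃ b', MacaulayRep d n (a - 1) b' ∧ b' < b := by
  induction h with
  | zero => omega
  | @cons d n m a b hm hlt h ih =>
    rcases Nat.eq_zero_or_pos a with rfl | ha'
    · obtain ⟨b', hb', hlt'⟩ := exists_choose_sub_one d m hm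
      exact ⟨b', hb'.mono hlt.le, by omega⟩
    · obtain ⟨b', hb', hlt'⟩ := ih ha'
      refine ⟨(m + 1).choose (d + 2) + b', ?_, ?_⟩
      · rw [Nat.add_sub_assoc ha']
        exact .cons hm hlt hb'
      · omega

/-- `a'` lowers all upper entries of the expansion of `a` by one (Green's bound); `a - a'` lowers
all entries by one. -/
theorem exists_split {d n a b : ℕ} (h : MacaulayRep d n a b) (ha : 0 < a) :
    ∃ d' a' b' c, d = d' + 1 ∧ MacaulayRep d (n - 1) a' b' ∧ a' < a ∧ b = a + b' ∧
      MacaulayRep d' (n - 1) (a - a' - 1) c ∧ c < a := by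
  induction h with
  | zero => omega
  | @cons d n m a b hm hlt h ih =>
    obtain ⟨m, rfl⟩ : ∃ k, m = k + 1 := ⟨m - 1, by omega⟩
    have e1 : (m + 1).choose (d + 1) = m.choose d + m.choose (d + 1) := Nat.choose_succ_succ _ _
    have e2 : (m + 1 + 1).choose (d + 2) = (m + 1).choose (d + 1) + (m + 1).choose (d + 2) :=
      Nat.choose_succ_succ _ _
    have hpos : 0 < m.choose d := Nat.choose_pos (by omega)
    -- If the leading term is C(d+1, d+1), lowering its upper entry gives 0, and the remaining terms
    -- have no room either.
    have key : ∀ a' b', MacaulayRep d m a' b' →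
        MacaulayRep (d + 1) (n - 1) (m.choose (d + 1) + a') ((m + 1).choose (d + 2) + b') := by
      intro a' b' h'
      rcases Nat.eq_or_lt_of_le hm with hm' | hm'
      · obtain rfl : m = d := by omega
        obtain ⟨rfl, rfl⟩ := h'.eq_zero_of_le le_rfl
        simpa using MacaulayRep.zero _ _
      · exact .cons (by omega) (by omega) h'
    rcases Nat.eq_zero_or_pos a with rfl | ha'
    · obtain rfl := h.eq_zero
      have hlow : ∃ c, MacaulayRep d (n - 1) (m.choose d - 1) c ∧ c < (m + 1).choose (d + 1) := by
        rcases d with _ | d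
        · exact ⟨0, by simpa using MacaulayRep.zero _ _, by omega⟩
        · obtain ⟨c, hc, hc'⟩ := exists_choose_sub_one d m (by omega)
          exact ⟨c, hc.mono (by omega), hc'⟩
      obtain ⟨c, hc, hc'⟩ := hlow
      refine ⟨d, _, _, c, rfl, key 0 0 (.zero _ _), by omega, by omega, ?_, by omega⟩
      convert hc using 1
      omega
    · obtain ⟨d', a', b', c, rfl, h1, h2, h3, h4, h5⟩ := ih ha'
      refine ⟨_, _, _, (m + 1).choose (d' + 2) + c, rfl, key a' b' h1, by omega, by omega, ?_, ?_⟩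
      · have := MacaulayRep.cons (n := n - 1) (m := m) (by omega) (by omega) h4
        convert this using 1
        omega
      · simp only [add_assoc, Nat.reduceAdd] at *
        omega

end MacaulayRep

theorem IsMacaulayExpansion.macaulayRep {a : ℤ} {i r : ℕ} {n : ℕ → ℕ}
    (h : IsMacaulayExpansion a i r n) :
    MacaulayRep i (n i + 1) (∑ j ∈ Finset.Icc r i, (n j).choose j)
      (∑ j ∈ Finset.Icc r i, (n j + 1).choose (j + 1)) := by
  obtain ⟨hr, hrn, hmono, -⟩ := h
  clear a
  induction i with
  | zero => simpa [Finset.Icc_eq_empty (show ¬ r ≤ 0 by omega)] using MacaulayRep.zero _ _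
  | succ i ih =>
    rcases Nat.lt_or_ge (i + 1) r with hlt | hle
    · rw [Finset.Icc_eq_empty (by omega)]
      simpa using MacaulayRep.zero _ _
    have hge : ∀ j, r ≤ j → j ≤ i + 1 → j ≤ n j := by
      intro j hj
      induction j, hj using Nat.le_induction with
      | base => intro _; exact hrn hle
      | succ j hj ihj =>
        intro hji
        have h1 := hmono (a := j) (b := j + 1) ⟨hj, by omega⟩ ⟨by omega, hji⟩ (by omega)
        have := ihj (by omega)
        omega
    rw [← Finset.insert_Icc_right_eq_Icc_add_one hle, Finset.sum_insert (by simp),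
      Finset.sum_insert (by simp)]
    refine .cons (hge _ hle le_rfl) (by omega) ?_
    rcases Nat.lt_or_ge i r with hlt | hle'
    · rw [Finset.Icc_eq_empty (by omega)]
      simpa using MacaulayRep.zero _ _
    refine (ih (fun _ => hrn hle) (hmono.mono (Set.Icc_subset_Icc_right (by omega)))).mono ?_
    exact hmono (a := i) (b := i + 1) ⟨hle', by omega⟩ ⟨by omega, le_rfl⟩ (by omega)

/-! ### Two-variable compression. -/

section Compression

open Finset Classical

variable {σ : Type*}

/-- The exponent vector `c` with the entries at `x` and `j` redistributed so that `j` gets `b`. -/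
noncomputable def slide (x j : σ) (c : σ →₀ ℕ) (b : ℕ) : σ →₀ ℕ :=
  (c.update j b).update x (c x + c j - b)

theorem slide_apply {x j : σ} (c : σ →₀ ℕ) (b : ℕ) (i : σ) :
    slide x j c b i = if i = x then c x + c j - b else if i = j then b else c i := by
  simp [slide, Function.update_apply]

theorem slide_self {x j : σ} (hxj : x ≠ j) (c : σ →₀ ℕ) : slide x j c (c j) = c := by
  ext i
  rw [slide_apply]
  split_ifs with h1 h2
  · subst h1; omega
  · rw [h2]
  · rfl

theorem slide_slide {x j : σ} (hxj : x ≠ j) (c : σ →₀ ℕ) {b : ℕ} (hb : b ≤ c x + c j) (b' : ℕ) :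
    slide x j (slide x j c b) b' = slide x j c b' := by
  ext i
  simp only [slide_apply, if_true, if_neg hxj.symm]
  split_ifs <;> omega

/-- The possible `j`-exponents of elements of `N` that agree with `c` outside `x` and `j` and have
the same total degree in `x` and `j`. -/
noncomputable def fiberExponents (x j : σ) (N : Finset (σ →₀ ℕ)) (c : σ →₀ ℕ) : Finset ℕ :=
  {b ∈ range (c x + c j + 1) | slide x j c b ∈ N}

theorem mem_fiberExponents {x j : σ} {N : Finset (σ →₀ ℕ)} {c : σ →₀ ℕ} {b : ℕ} :
    b ∈ fiberExponents x j N c ↔ b ≤ c x + c j ∧ slide x j c b ∈ N := by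
  simp [fiberExponents]

theorem fiberExponents_slide {x j : σ} (hxj : x ≠ j) (N : Finset (σ →₀ ℕ)) (c : σ →₀ ℕ) {b : ℕ}
    (hb : b ≤ c x + c j) :
    fiberExponents x j N (slide x j c b) = fiberExponents x j N c := by
  ext b'
  rw [mem_fiberExponents, mem_fiberExponents, slide_slide hxj c hb]
  simp only [slide_apply, if_true, if_neg hxj.symm]
  rw [Nat.sub_add_cancel hb]

theorem self_mem_fiberExponents {x j : σ} (hxj : x ≠ j) {N : Finset (σ →₀ ℕ)} {c : σ →₀ ℕ} :
    c j ∈ fiberExponents x j N c ↔ c ∈ N := by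
  rw [mem_fiberExponents, slide_self hxj]
  simp

theorem card_filter_lt_strictMonoOn (S : Finset ℕ) :
    StrictMonoOn (fun b => #{y ∈ S | y < b}) (S : Set ℕ) := by
  intro a ha b hb hab
  refine card_lt_card ⟨fun y hy => ?_, fun hsub => ?_⟩
  · simp only [mem_filter] at hy ⊢
    exact ⟨hy.1, hy.2.trans hab⟩
  · have := hsub (mem_filter.2 ⟨mem_coe.1 ha, hab⟩)
    simp at this

theorem card_filter_lt_le (S : Finset ℕ) (b : ℕ) : #{y ∈ S | y < b} ≤ b := by
  calc #{y ∈ S | y < b} ≤ #(range b) := card_le_card fun y hy => by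
        simpa using (mem_filter.1 hy).2
    _ = b := card_range b

theorem exists_card_filter_lt_eq (S : Finset ℕ) {r : ℕ} (hr : r < #S) :
    ∃ b ∈ S, #{y ∈ S | y < b} = r := by
  have himg : S.image (fun b => #{y ∈ S | y < b}) = range #S := by
    refine eq_of_subset_of_card_le (fun r hr => ?_) ?_
    · obtain ⟨b, hb, rfl⟩ := mem_image.1 hr
      rw [mem_range]
      refine card_lt_card ⟨filter_subset _ _, fun hsub => ?_⟩
      have := hsub hb
      simp at this
    · rw [card_range, card_image_of_injOn (card_filter_lt_strictMonoOn S).injOn]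
  have : r ∈ S.image (fun b => #{y ∈ S | y < b}) := by rwa [himg, mem_range]
  simpa using this

/-- The rank of `c j` in its fiber. -/
noncomputable def fiberRank (x j : σ) (N : Finset (σ →₀ ℕ)) (c : σ →₀ ℕ) : ℕ :=
  #{y ∈ fiberExponents x j N c | y < c j}

theorem fiberRank_le {x j : σ} (N : Finset (σ →₀ ℕ)) (c : σ →₀ ℕ) :
    fiberRank x j N c ≤ c j :=
  card_filter_lt_le _ _

/-- Two-variable compression: every fiber is replaced by an initial segment. -/
noncomputable def compress (x j : σ) (N : Finset (σ →₀ ℕ)) : Finset (σ →₀ ℕ) :=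
  N.image fun c => slide x j c (fiberRank x j N c)

/-- Sliding stays within the fiber, and the rank recovers the original exponent. -/
theorem slide_fiberRank_injOn {x j : σ} (hxj : x ≠ j) (N : Finset (σ →₀ ℕ)) :
    Set.InjOn (fun c => slide x j c (fiberRank x j N c)) (N : Set (σ →₀ ℕ)) := by
  intro c hc c' hc' h
  simp only at h
  have hb : fiberRank x j N c ≤ c x + c j := (fiberRank_le N c).trans (by omega)
  have hb' : fiberRank x j N c' ≤ c' x + c' j := (fiberRank_le N c').trans (by omega)
  have hS : fiberExponents x j N c = fiberExponents x j N c' := by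
    rw [← fiberExponents_slide hxj N c hb, h, fiberExponents_slide hxj N c' hb']
  have hr : fiberRank x j N c = fiberRank x j N c' := by
    have := DFunLike.congr_fun h j
    simpa only [slide_apply, if_neg hxj.symm, if_true] using this
  have hj : c j = c' j := by
    refine (card_filter_lt_strictMonoOn (fiberExponents x j N c)).injOn
      ((self_mem_fiberExponents hxj).2 hc) ?_ ?_
    · rw [hS]
      exact (self_mem_fiberExponents hxj).2 hc'
    · unfold fiberRank at hr
      rw [← hS] at hr
      exact hr
  have e := slide_slide hxj c hb (c j)
  rw [h, slide_slide hxj c' hb', slide_self hxj, hj, slide_self hxj] at e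
  exact e.symm

theorem card_compress {x j : σ} (hxj : x ≠ j) (N : Finset (σ →₀ ℕ)) :
    #(compress x j N) = #N :=
  card_image_of_injOn (slide_fiberRank_injOn hxj N)

/-- Each fiber of the compression is {0, …, size - 1} in the `j`-exponent. -/
theorem mem_compress {x j : σ} (hxj : x ≠ j) {N : Finset (σ →₀ ℕ)} {c : σ →₀ ℕ} :
    c ∈ compress x j N ↔ c j < #(fiberExponents x j N c) := by
  constructor
  · intro h
    obtain ⟨c, hc, rfl⟩ := mem_image.1 h
    rw [fiberExponents_slide hxj N c ((fiberRank_le N c).trans (by omega))]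
    simp only [slide_apply, if_neg hxj.symm, if_true]
    refine card_lt_card ⟨filter_subset _ _, fun hsub => ?_⟩
    have := hsub ((self_mem_fiberExponents hxj).2 hc)
    simp at this
  · intro h
    obtain ⟨b, hb, hbr⟩ := exists_card_filter_lt_eq _ h
    have hb' := mem_fiberExponents.1 hb
    refine mem_image.2 ⟨_, hb'.2, ?_⟩
    have : fiberRank x j N (slide x j c b) = c j := by
      rw [fiberRank, fiberExponents_slide hxj N c hb'.1]
      simpa only [slide_apply, if_neg hxj.symm, if_true] using hbr
    rw [this, slide_slide hxj c hb'.1, slide_self hxj]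

theorem degree_slide {x j : σ} (hxj : x ≠ j) (c : σ →₀ ℕ) {b : ℕ} (hb : b ≤ c x + c j) :
    (slide x j c b).degree = c.degree := by
  have key : ∀ c : σ →₀ ℕ, c = Finsupp.single x (c x) + Finsupp.single j (c j)
      + (c.erase x).erase j := by
    intro c
    ext i
    by_cases h1 : i = x
    · subst h1; simp [hxj]
    · by_cases h2 : i = j
      · subst h2; simp [hxj.symm]
      · simp [h1, h2]
  have he : ((slide x j c b).erase x).erase j = (c.erase x).erase j := by
    ext i
    by_cases h1 : i = x
    · subst h1; simp [hxj]
    · by_cases h2 : i = j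
      · subst h2; simp
      · simp [h1, h2, slide_apply]
  have e1 := congrArg Finsupp.degree (key (slide x j c b))
  have e2 := congrArg Finsupp.degree (key c)
  rw [he] at e1
  simp only [map_add, Finsupp.degree_single, slide_apply, if_true, if_neg hxj.symm] at e1 e2
  omega

/-- This is the shadow bound in two variables. If `S` misses some g, keep the elements below g and
shift down those above: this is injective. If `S` misses nothing, `T` contains all of 0, …, t. -/
theorem min_card_le_of_shift {S T : Finset ℕ} {t : ℕ} (hS : ∀ b ∈ S, b ≤ t + 1)
    (h1 : ∀ b ∈ S, b ≤ t → b ∈ T) (h2 : ∀ b ∈ S, 1 ≤ b → b - 1 ∈ T) :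
    min #S (t + 1) ≤ #T := by
  by_cases hg : ∃ g ≤ t + 1, g ∉ S
  · obtain ⟨g, hgt, hg⟩ := hg
    refine (min_le_left _ _).trans ?_
    refine card_le_card_of_injOn (fun b => if b < g then b else b - 1) (fun b hb => ?_) ?_
    · have hbg : b ≠ g := fun h => hg (h ▸ hb)
      have := hS b hb
      simp only
      split_ifs with h
      · exact h1 b hb (by omega)
      · exact h2 b hb (by omega)
    · intro a ha b hb hab
      have hag : a ≠ g := fun h => hg (h ▸ ha)
      have hbg : b ≠ g := fun h => hg (h ▸ hb)
      simp only at hab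
      split_ifs at hab <;> omega
  · push Not at hg
    refine (min_le_right _ _).trans ?_
    rw [← card_range (t + 1)]
    refine card_le_card fun b hb => ?_
    rw [mem_range] at hb
    exact h1 b (hg b (by omega)) (by omega)

theorem compress_shadow {x j : σ} (hxj : x ≠ j) {N M : Finset (σ →₀ ℕ)}
    (h : ∀ c ∈ N, ∀ i, c i ≠ 0 → c - Finsupp.single i 1 ∈ M) :
    ∀ c ∈ compress x j N, ∀ i, c i ≠ 0 → c - Finsupp.single i 1 ∈ compress x j M := by
  intro c hc i hi
  rw [mem_compress hxj] at hc ⊢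
  by_cases hij : i = x ∨ i = j
  · have htot : (c - Finsupp.single i 1 : σ →₀ ℕ) x + (c - Finsupp.single i 1 : σ →₀ ℕ) j + 1 = c x + c j := by
      rcases hij with rfl | rfl
      · simp [hxj]; omega
      · simp [hxj.symm]; omega
    have hmin : min #(fiberExponents x j N c) (c x + c j) ≤
        #(fiberExponents x j M (c - Finsupp.single i 1)) := by
      rw [← htot]
      have hoff : ∀ y, y ≠ x → y ≠ j → (c - Finsupp.single i 1 : σ →₀ ℕ) y = c y := by
        intro y h1 h2
        have : y ≠ i := by rintro rfl; tauto
        simp [this.symm]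
      refine min_card_le_of_shift (fun b hb => ?_) (fun b hb hbt => ?_) (fun b hb hb1 => ?_)
      · rw [htot]; exact (mem_fiberExponents.1 hb).1
      · refine mem_fiberExponents.2 ⟨hbt, ?_⟩
        have h1 := h _ (mem_fiberExponents.1 hb).2 x (by rw [slide_apply, if_pos rfl]; omega)
        convert h1 using 1
        ext y
        rw [Finsupp.tsub_apply, slide_apply, slide_apply, Finsupp.single_apply]
        by_cases hy : y = x
        · subst hy; simp only [if_true]; omega
        · rw [if_neg hy, if_neg hy, if_neg (Ne.symm hy)]
          by_cases hy2 : y = j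
          · simp [hy2]
          · simp only [if_neg hy2, hoff y hy hy2]; omega
      · have hb' := mem_fiberExponents.1 hb
        refine mem_fiberExponents.2 ⟨by omega, ?_⟩
        have h1 := h _ hb'.2 j (by rw [slide_apply, if_neg hxj.symm, if_pos rfl]; omega)
        convert h1 using 1
        ext y
        rw [Finsupp.tsub_apply, slide_apply, slide_apply, Finsupp.single_apply]
        by_cases hy : y = x
        · subst hy; simp only [if_true, if_neg hxj.symm]; omega
        · rw [if_neg hy, if_neg hy]
          by_cases hy2 : y = j
          · simp [hy2]
          · simp only [if_neg hy2, if_neg (Ne.symm hy2), hoff y hy hy2]; omega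
    refine lt_of_lt_of_le ?_ hmin
    rcases hij with rfl | rfl
    · simp [hxj]; omega
    · simp; omega
  · push Not at hij
    obtain ⟨h1, h2⟩ := hij
    have ex : (c - Finsupp.single i 1 : σ →₀ ℕ) x = c x := by simp [h1]
    have ej : (c - Finsupp.single i 1 : σ →₀ ℕ) j = c j := by simp [h2]
    rw [ej]
    refine hc.trans_le (card_le_card fun b hb => ?_)
    have hb' := mem_fiberExponents.1 hb
    refine mem_fiberExponents.2 ⟨by omega, ?_⟩
    have h3 := h _ hb'.2 i (by rwa [slide_apply, if_neg h1, if_neg h2])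
    convert h3 using 1
    ext y
    rw [Finsupp.tsub_apply, slide_apply, slide_apply, ex, ej, Finsupp.single_apply]
    by_cases hy : y = x
    · subst hy; simp [h1]
    · by_cases hy2 : y = j
      · subst hy2; simp [h2, hy]
      · simp [hy, hy2, Finsupp.single_apply]

/-- `N` is closed under replacing a variable by `x`. -/
def IsStableAt (x : σ) (N : Finset (σ →₀ ℕ)) : Prop :=
  ∀ c ∈ N, ∀ j, j ≠ x → c j ≠ 0 → c - Finsupp.single j 1 + Finsupp.single x 1 ∈ N

theorem exists_isStableAt (x : σ) (s : Finset σ) (hx : x ∈ s) (d : ℕ) (N M : Finset (σ →₀ ℕ))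
    (hN : ∀ c ∈ N, c.degree = d ∧ c.support ⊆ s)
    (h : ∀ c ∈ N, ∀ i, c i ≠ 0 → c - Finsupp.single i 1 ∈ M) :
    ∃ N' M' : Finset (σ →₀ ℕ), #N' = #N ∧ #M' = #M ∧
      (∀ c ∈ N', c.degree = d ∧ c.support ⊆ s) ∧
      (∀ c ∈ N', ∀ i, c i ≠ 0 → c - Finsupp.single i 1 ∈ M') ∧ IsStableAt x N' := by
  -- Compression only raises `x`-exponents, and raises one strictly as long as stability fails.
  induction hp : ∑ c ∈ N, (d - c x) using Nat.strong_induction_on generalizing N M with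
  | _ p ih =>
  by_cases hst : IsStableAt x N
  · exact ⟨N, M, rfl, rfl, hN, h, hst⟩
  unfold IsStableAt at hst
  push Not at hst
  obtain ⟨c, hc, j, hjx, hj, hc'⟩ := hst
  have hxj := hjx.symm
  have hle : ∀ c ∈ N, fiberRank x j N c ≤ c x + c j := fun c _ =>
    (fiberRank_le N c).trans (by omega)
  have hdeg : ∀ c' ∈ compress x j N, c'.degree = d ∧ c'.support ⊆ s := by
    intro c' hc'
    obtain ⟨c, hc, rfl⟩ := mem_image.1 hc'
    refine ⟨by rw [degree_slide hxj c (hle c hc), (hN c hc).1], fun i hi => ?_⟩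
    rw [Finsupp.mem_support_iff, slide_apply] at hi
    split_ifs at hi with h1 h2
    · exact h1 ▸ hx
    · apply (hN c hc).2
      rw [Finsupp.mem_support_iff, h2]
      have := fiberRank_le (x := x) (j := j) N c
      omega
    · exact (hN c hc).2 (Finsupp.mem_support_iff.2 hi)
  obtain ⟨N', M', h1, h2, h3⟩ := ih (∑ c ∈ compress x j N, (d - c x)) (by
    rw [← hp, compress, sum_image (slide_fiberRank_injOn hxj N)]
    have hval : ∀ c, slide x j c (fiberRank x j N c) x = c x + c j - fiberRank x j N c := by
      intro c; rw [slide_apply, if_pos rfl]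
    refine sum_lt_sum (fun c hc => ?_) ⟨c, hc, ?_⟩
    · rw [hval]
      have := fiberRank_le (x := x) (j := j) N c
      omega
    · rw [hval]
      have hlt : fiberRank x j N c < c j := by
        -- Rank equal to `c j` would put every smaller exponent in the fiber, in particular `c j -
        -- 1`, which is the missing monomial.
        refine lt_of_le_of_ne (fiberRank_le N c) fun heq => hc' ?_
        have hsub : {y ∈ fiberExponents x j N c | y < c j} = range (c j) :=
          eq_of_subset_of_card_le (fun y hy => by simpa using (mem_filter.1 hy).2)
            (by rw [card_range]; exact heq.ge)
        have hmem : c j - 1 ∈ fiberExponents x j N c := by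
          have : c j - 1 ∈ range (c j) := by rw [mem_range]; omega
          rw [← hsub] at this
          exact (mem_filter.1 this).1
        convert (mem_fiberExponents.1 hmem).2 using 1
        ext y
        rw [slide_apply]
        by_cases hy : y = x
        · subst hy; simp [hjx]; omega
        · by_cases hy2 : y = j
          · subst hy2; simp [hjx]
          · simp [hy, hy2]
      have hx_le : c x + c j ≤ d := by
        rw [← (hN c hc).1]
        have := degree_slide hxj c (b := 0) (by omega)
        rw [← this]
        refine le_trans ?_ (Finsupp.le_degree x _)
        rw [slide_apply, if_pos rfl]
        omega
      omega) (compress x j N) (compress x j M) hdeg (compress_shadow hxj h) rfl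
  exact ⟨N', M', h1.trans (card_compress hxj N), h2.trans (card_compress hxj M), h3⟩

end Compression

/-! ### Macaulay's growth bound. -/

section Macaulay

open Finset Classical

variable {σ : Type*}

/-- The quotients by `x` of the elements of `N` divisible by `x`. -/
noncomputable def quotientByVar (x : σ) (N : Finset (σ →₀ ℕ)) : Finset (σ →₀ ℕ) :=
  {c ∈ N | c x ≠ 0}.image (· - Finsupp.single x 1)

theorem sub_single_add_single {x : σ} {c : σ →₀ ℕ} (h : c x ≠ 0) :
    c - Finsupp.single x 1 + Finsupp.single x 1 = c :=
  tsub_add_cancel_of_le (by simpa using Nat.one_le_iff_ne_zero.2 h)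

theorem mem_quotientByVar {x : σ} {N : Finset (σ →₀ ℕ)} {c : σ →₀ ℕ} :
    c ∈ quotientByVar x N ↔ c + Finsupp.single x 1 ∈ N := by
  simp only [quotientByVar, mem_image, mem_filter]
  constructor
  · rintro ⟨c, ⟨hc, hx⟩, rfl⟩
    rwa [sub_single_add_single hx]
  · intro h
    exact ⟨_, ⟨h, by simp⟩, add_tsub_cancel_right _ _⟩

theorem card_filter_add_card_quotientByVar (x : σ) (N : Finset (σ →₀ ℕ)) :
    #{c ∈ N | c x = 0} + #(quotientByVar x N) = #N := by
  rw [quotientByVar, card_image_of_injOn, card_filter_add_card_filter_not]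
  intro c hc c' hc' h
  have h1 := (mem_filter.1 (mem_coe.1 hc)).2
  have h2 := (mem_filter.1 (mem_coe.1 hc')).2
  simp only at h
  rw [← sub_single_add_single h1, h, sub_single_add_single h2]

/-- For a stable set, the whole shadow is already obtained by dividing by `x`. -/
theorem IsStableAt.sub_single_mem_quotientByVar {x : σ} {N : Finset (σ →₀ ℕ)} (h : IsStableAt x N)
    {c : σ →₀ ℕ} (hc : c ∈ N) {j : σ} (hj : c j ≠ 0) : c - Finsupp.single j 1 ∈ quotientByVar x N := by
  rw [mem_quotientByVar]
  by_cases hjx : j = x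
  · subst hjx
    rwa [sub_single_add_single hj]
  · exact h c hc j hjx hj

theorem IsStableAt.quotientByVar {x : σ} {N : Finset (σ →₀ ℕ)} (h : IsStableAt x N) :
    IsStableAt x (quotientByVar x N) := by
  intro c hc j hjx hj
  rw [mem_quotientByVar] at hc ⊢
  convert h _ hc j hjx (by simp [hj]) using 1
  ext y
  by_cases h1 : y = x
  · subst h1; simp [Ne.symm hjx]
  · by_cases h2 : y = j
    · subst h2; simp [hjx]
    · simp [h1, h2]

/-- Macaulay's bound for the growth of a multicomplex. -/
theorem card_le_of_macaulayRep (s : Finset σ) (d : ℕ) {n a b : ℕ} (hab : MacaulayRep d n a b)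
    (N M : Finset (σ →₀ ℕ)) (hN : ∀ c ∈ N, c.degree = d + 1 ∧ c.support ⊆ s)
    (h : ∀ c ∈ N, ∀ i, c i ≠ 0 → c - Finsupp.single i 1 ∈ M) (hM : #M ≤ a) : #N ≤ b := by
  induction s using Finset.induction_on generalizing d n a b N M with
  | empty =>
    rw [card_eq_zero.2]
    · exact Nat.zero_le _
    · refine eq_empty_of_forall_notMem fun c hc => ?_
      obtain ⟨h1, h2⟩ := hN c hc
      rw [subset_empty, Finsupp.support_eq_empty] at h2
      simp [h2] at h1
  | insert x s hxs ihs =>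
  induction d using Nat.strong_induction_on generalizing n a b N M with
  | _ d ihd =>
  induction a using Nat.strong_induction_on generalizing n b N M with
  | _ a iha =>
  obtain ⟨N, M', hN', hM', hNd, hsh, hst⟩ := exists_isStableAt x _ (mem_insert_self x s) _ N M hN h
  rw [← hN']
  rw [← hM'] at hM
  clear h hN
  rcases Nat.eq_zero_or_pos a with rfl | ha
  · rw [card_eq_zero.2]
    · exact Nat.zero_le _
    · refine eq_empty_of_forall_notMem fun c hc => ?_
      have hne : c ≠ 0 := by
        rintro rfl
        simpa using (hNd 0 hc).1
      obtain ⟨i, hi⟩ := Finsupp.ne_iff.1 hne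
      have := hsh c hc i hi
      rw [card_eq_zero.1 (Nat.le_zero.1 hM)] at this
      simp at this
  have hslice : quotientByVar x N ⊆ M' := by
    intro c hc
    have := hsh _ (mem_quotientByVar.1 hc) x (by simp)
    rwa [add_tsub_cancel_right] at this
  have hshs : ∀ c ∈ N, ∀ i, c i ≠ 0 → c - Finsupp.single i 1 ∈ quotientByVar x N :=
    fun c hc i hi => hst.sub_single_mem_quotientByVar hc hi
  have hle : #(quotientByVar x N) ≤ a := (card_le_card hslice).trans hM
  -- The quotient by `x` contains the shadow, so it can replace `M'`; if it has fewer than `a`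
  -- elements, induction on `a` applies.
  rcases Nat.lt_or_eq_of_le hle with hlt | heq
  · obtain ⟨b', hb', hlt'⟩ := hab.exists_sub_one ha
    exact (iha (a - 1) (by omega) hb' N (quotientByVar x N) hNd hshs (by omega)).trans hlt'.le
  obtain ⟨d, a', b', e, rfl, h1, h2, rfl, h3, h4⟩ := hab.exists_split ha
  have hNd' : ∀ c ∈ quotientByVar x N, c.degree = d + 1 ∧ c.support ⊆ insert x s := by
    intro c hc
    obtain ⟨h5, h6⟩ := hNd _ (mem_quotientByVar.1 hc)
    refine ⟨by simpa using h5, fun i hi => h6 ?_⟩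
    rw [Finsupp.mem_support_iff] at hi ⊢
    rw [Finsupp.add_apply]
    omega
  -- Otherwise the second quotient by `x` has at most a - a' - 1 elements, and the bound one degree
  -- lower gives the first quotient at most `e` < a elements, though it has exactly a.
  have hgreen : #{c ∈ quotientByVar x N | c x = 0} ≤ a' := by
    by_contra! hcon
    have hsum := card_filter_add_card_quotientByVar x (quotientByVar x N)
    have := ihd d (by omega) h3 (quotientByVar x N) (quotientByVar x (quotientByVar x N)) hNd'
      (fun c hc i hi => hst.quotientByVar.sub_single_mem_quotientByVar hc hi) (by omega)
    omega
  -- The elements free of `x` involve one variable fewer; those divisible by `x` number a, and the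
  -- target is a + b'.
  have hrest : #{c ∈ N | c x = 0} ≤ b' := by
    refine ihs (d + 1) h1 _ {c ∈ quotientByVar x N | c x = 0} (fun c hc => ?_) (fun c hc i hi => ?_) hgreen
    · obtain ⟨hc, hcx⟩ := mem_filter.1 hc
      refine ⟨(hNd c hc).1, fun i hi => ?_⟩
      rcases mem_insert.1 ((hNd c hc).2 hi) with rfl | his
      · simp [hcx] at hi
      · exact his
    · obtain ⟨hc, hcx⟩ := mem_filter.1 hc
      exact mem_filter.2 ⟨hshs c hc i hi, by simp [hcx]⟩
  have := card_filter_add_card_quotientByVar x N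
  omega

end Macaulay

/-! ### Hard Lefschetz through `sl₂`. -/

section Lefschetz

variable {σ : Type*} [Fintype σ]

/-- Multiplication by the sum of the variables, on coefficient functions. -/
noncomputable def raiseOp : ((σ →₀ ℕ) → ℚ) →ₗ[ℚ] ((σ →₀ ℕ) → ℚ) where
  toFun v c := ∑ s, if c s = 0 then 0 else v (c - Finsupp.single s 1)
  map_add' v w := by
    ext c
    simp only [Pi.add_apply, ← Finset.sum_add_distrib]
    exact Finset.sum_congr rfl fun s _ => by split_ifs <;> simp
  map_smul' r v := by
    ext c
    simp only [Pi.smul_apply, smul_eq_mul, Finset.mul_sum, RingHom.id_apply]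
    exact Finset.sum_congr rfl fun s _ => by split_ifs <;> simp

/-- The lowering operator that forms an `sl₂`-triple with `raiseOp` on the divisors of `m`. -/
noncomputable def lowerOp (m : σ →₀ ℕ) : ((σ →₀ ℕ) → ℚ) →ₗ[ℚ] ((σ →₀ ℕ) → ℚ) where
  toFun v c := ∑ s, ((m s : ℚ) - c s) * (c s + 1) * v (c + Finsupp.single s 1)
  map_add' v w := by
    ext c
    simp only [Pi.add_apply, ← Finset.sum_add_distrib, mul_add]
  map_smul' r v := by
    ext c
    simp only [Pi.smul_apply, smul_eq_mul, Finset.mul_sum, RingHom.id_apply]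
    exact Finset.sum_congr rfl fun s _ => by ring

theorem raiseOp_apply (v : (σ →₀ ℕ) → ℚ) (c : σ →₀ ℕ) :
    raiseOp v c = ∑ s, if c s = 0 then 0 else v (c - Finsupp.single s 1) := rfl

theorem lowerOp_apply (m : σ →₀ ℕ) (v : (σ →₀ ℕ) → ℚ) (c : σ →₀ ℕ) :
    lowerOp m v c = ∑ s, ((m s : ℚ) - c s) * (c s + 1) * v (c + Finsupp.single s 1) := rfl

theorem raiseOp_pow_succ (p : ℕ) (v : (σ →₀ ℕ) → ℚ) :
    (raiseOp ^ (p + 1)) v = raiseOp ((raiseOp ^ p) v) := by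
  rw [pow_succ', Module.End.mul_apply]

/-- Off-diagonal terms cancel; on the diagonal, (m-c)(c+1) - c(m-c+1) = m - 2c. -/
theorem lowerOp_raiseOp (m : σ →₀ ℕ) (v : (σ →₀ ℕ) → ℚ) (c : σ →₀ ℕ) :
    lowerOp m (raiseOp v) c =
      raiseOp (lowerOp m v) c + ((m.degree : ℚ) - 2 * c.degree) * v c := by
  classical
  have hdiag : ((m.degree : ℚ) - 2 * c.degree) * v c =
      ∑ s, ∑ t, if s = t then ((m s : ℚ) - 2 * c s) * v c else 0 := by
    simp only [Finset.sum_ite_eq, Finset.mem_univ, if_true, ← Finset.sum_mul,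
      Finset.sum_sub_distrib, ← Finset.mul_sum, Finsupp.degree_eq_sum, Nat.cast_sum]
  have hraise : raiseOp (lowerOp m v) c = ∑ s, ∑ t, if c t = 0 then 0 else
      ((m s : ℚ) - (c - Finsupp.single t 1 : σ →₀ ℕ) s) *
        ((c - Finsupp.single t 1 : σ →₀ ℕ) s + 1) *
          v (c - Finsupp.single t 1 + Finsupp.single s 1) := by
    rw [Finset.sum_comm, raiseOp_apply]
    refine Finset.sum_congr rfl fun t _ => ?_
    split_ifs with h
    · simp
    · rw [lowerOp_apply]
  rw [hdiag, hraise, lowerOp_apply, ← Finset.sum_add_distrib]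
  refine Finset.sum_congr rfl fun s _ => ?_
  rw [raiseOp_apply, Finset.mul_sum, ← Finset.sum_add_distrib]
  refine Finset.sum_congr rfl fun t _ => ?_
  by_cases hst : s = t
  · subst hst
    rw [if_neg (by simp), if_pos rfl, add_tsub_cancel_right]
    split_ifs with h
    · rw [h]; push_cast; ring
    · rw [sub_single_add_single h, Finsupp.tsub_apply, Finsupp.single_eq_same,
        Nat.cast_sub (Nat.one_le_iff_ne_zero.2 h)]
      push_cast
      ring
  · have e1 : (c + Finsupp.single s 1 : σ →₀ ℕ) t = c t := by simp [hst]
    have e2 : (c - Finsupp.single t 1 : σ →₀ ℕ) s = c s := by simp [Ne.symm hst]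
    rw [if_neg hst, e1, e2, add_zero]
    split_ifs with h
    · simp
    · congr 2
      rw [tsub_add_eq_add_tsub]
      simpa using Nat.one_le_iff_ne_zero.2 h

/-- The function `v` is supported in degree `i`. -/
noncomputable def IsHomogeneousFun (i : ℕ) (v : (σ →₀ ℕ) → ℚ) : Prop := ∀ c, v c ≠ 0 → c.degree = i

theorem degree_sub_single_add_one {σ : Type*} {s : σ} {c : σ →₀ ℕ} (h : c s ≠ 0) :
    (c - Finsupp.single s 1).degree + 1 = c.degree := by
  have := congrArg Finsupp.degree (sub_single_add_single h)
  rwa [map_add, Finsupp.degree_single] at this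

theorem IsHomogeneousFun.raiseOp {i : ℕ} {v : (σ →₀ ℕ) → ℚ} (hv : IsHomogeneousFun i v) :
    IsHomogeneousFun (i + 1) (raiseOp v) := by
  intro c hc
  rw [raiseOp_apply] at hc
  obtain ⟨s, -, hs⟩ := Finset.exists_ne_zero_of_sum_ne_zero hc
  split_ifs at hs with h
  · exact absurd rfl hs
  · rw [← hv _ hs, degree_sub_single_add_one h]

theorem IsHomogeneousFun.raiseOp_pow {i : ℕ} {v : (σ →₀ ℕ) → ℚ} (hv : IsHomogeneousFun i v)
    (p : ℕ) : IsHomogeneousFun (i + p) ((_root_.raiseOp ^ p) v) := by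
  induction p with
  | zero => exact hv
  | succ p ih =>
    rw [raiseOp_pow_succ]
    exact ih.raiseOp

theorem IsHomogeneousFun.lowerOp {i : ℕ} {v : (σ →₀ ℕ) → ℚ} (hv : IsHomogeneousFun (i + 1) v)
    (m : σ →₀ ℕ) : IsHomogeneousFun i (lowerOp m v) := by
  intro c hc
  rw [lowerOp_apply] at hc
  obtain ⟨s, -, hs⟩ := Finset.exists_ne_zero_of_sum_ne_zero hc
  have := hv _ (right_ne_zero_of_mul hs)
  simpa using this

theorem lowerOp_eq_zero {v : (σ →₀ ℕ) → ℚ} (hv : IsHomogeneousFun 0 v) (m : σ →₀ ℕ) :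
    lowerOp m v = 0 := by
  ext c
  rw [lowerOp_apply]
  refine Finset.sum_eq_zero fun s _ => ?_
  by_contra hs
  have := hv _ (right_ne_zero_of_mul hs)
  simp at this

theorem lowerOp_raiseOp_pow (m : σ →₀ ℕ) {i : ℕ} {v : (σ →₀ ℕ) → ℚ} (hv : IsHomogeneousFun i v)
    (p : ℕ) :
    lowerOp m ((raiseOp ^ (p + 1)) v) = (raiseOp ^ (p + 1)) (lowerOp m v) +
      (((p : ℚ) + 1) * (m.degree - 2 * i - p)) • (raiseOp ^ p) v := by
  have hstep : ∀ p : ℕ, lowerOp m ((raiseOp ^ (p + 1)) v) = raiseOp (lowerOp m ((raiseOp ^ p) v)) +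
      ((m.degree : ℚ) - 2 * (i + p)) • (raiseOp ^ p) v := by
    intro p
    ext c
    rw [raiseOp_pow_succ, lowerOp_raiseOp, Pi.add_apply, Pi.smul_apply, smul_eq_mul]
    congr 1
    by_cases hc : (raiseOp ^ p) v c = 0
    · rw [hc, mul_zero, mul_zero]
    · rw [hv.raiseOp_pow p c hc]
      push_cast
      ring
  induction p with
  | zero =>
    rw [hstep]
    simp
  | succ p ih =>
    rw [hstep, ih, map_add, map_smul, ← raiseOp_pow_succ, ← raiseOp_pow_succ, add_assoc, ← add_smul]
    congr 2
    push_cast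
    ring

theorem raiseOp_vanishes {m : σ →₀ ℕ} {v : (σ →₀ ℕ) → ℚ} (hv : ∀ c ≤ m, v c = 0) :
    ∀ c ≤ m, raiseOp v c = 0 := by
  intro c hc
  refine Finset.sum_eq_zero fun s _ => ?_
  rw [hv _ (tsub_le_self.trans hc), ite_self]

/-- The factor `m s - c s` kills the terms leaving the divisors of `m`, so the operator descends to
functions on these divisors. -/
theorem lowerOp_vanishes {m : σ →₀ ℕ} {v : (σ →₀ ℕ) → ℚ} (hv : ∀ c ≤ m, v c = 0) :
    ∀ c ≤ m, lowerOp m v c = 0 := by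
  classical
  intro c hc
  refine Finset.sum_eq_zero fun s _ => ?_
  rcases Nat.eq_or_lt_of_le (hc s) with h | h
  · rw [h, sub_self, zero_mul, zero_mul]
  · rw [hv, mul_zero]
    intro t
    rw [Finsupp.add_apply, Finsupp.single_apply]
    split_ifs with hst
    · subst hst; exact h
    · exact hc t

/-- The hard Lefschetz property of a monomial complete intersection. -/
theorem vanishes_of_raiseOp_pow_vanishes (m : σ →₀ ℕ) (i p : ℕ) (hip : 2 * i + p ≤ m.degree)
    (v : (σ →₀ ℕ) → ℚ) (hv : IsHomogeneousFun i v) (h : ∀ c ≤ m, (raiseOp ^ p) v c = 0) :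
    ∀ c ≤ m, v c = 0 := by
  induction i generalizing p v with
  | zero =>
    induction p with
    | zero => exact h
    | succ p ih =>
      refine ih (by omega) fun c hc => ?_
      have h1 := lowerOp_vanishes h c hc
      rw [lowerOp_raiseOp_pow m hv, lowerOp_eq_zero hv, map_zero, zero_add, Pi.smul_apply,
        smul_eq_mul, mul_eq_zero] at h1
      refine h1.resolve_left (mul_ne_zero (by positivity) ?_)
      have : (p : ℚ) + 1 ≤ m.degree := by exact_mod_cast (by omega : p + 1 ≤ m.degree)
      push_cast
      linarith
  | succ i ihi =>
    induction p with
    | zero => exact h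
    | succ p ih =>
      have h0 := lowerOp_raiseOp_pow m hv p
      have h1 := lowerOp_vanishes h
      -- Raising the commutation formula once more removes its scalar term, so the `p + 2`-nd power
      -- kills `lowerOp m v`; degree drops by 1 and the power grows by 2 relative to `p`, keeping 2i
      -- + p fixed.
      have h2 : ∀ c ≤ m, lowerOp m v c = 0 := by
        refine ihi (p + 2) (by omega) _ (hv.lowerOp m) fun c hc => ?_
        have h3 := congrFun (congrArg raiseOp h0) c
        rw [raiseOp_vanishes h1 c hc, map_add, map_smul, ← raiseOp_pow_succ,
          ← raiseOp_pow_succ, Pi.add_apply, Pi.smul_apply, h c hc, smul_zero,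
          add_zero] at h3
        exact h3.symm
      have h4 : ∀ q, ∀ c ≤ m, (raiseOp ^ q) (lowerOp m v) c = 0 := by
        intro q
        induction q with
        | zero => exact h2
        | succ q ihq =>
          rw [raiseOp_pow_succ]
          exact raiseOp_vanishes ihq
      refine ih (by omega) fun c hc => ?_
      have h5 := h1 c hc
      rw [h0, Pi.add_apply, h4 _ c hc, zero_add, Pi.smul_apply, smul_eq_mul, mul_eq_zero] at h5
      refine h5.resolve_left (mul_ne_zero (by positivity) ?_)
      have : 2 * ((i : ℚ) + 1) + p + 1 ≤ m.degree := by
        exact_mod_cast (by omega : 2 * (i + 1) + p + 1 ≤ m.degree)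
      push_cast
      linarith

end Lefschetz

/-! ### Initial positions of a subspace. -/

section InitialPositions

open Finset Classical

variable {ι β : Type*} [Fintype ι] [LinearOrder β]

/-- The positions of the first nonzero entries of elements of `W`, in the order given by `φ`. -/
noncomputable def initialPositions (φ : ι → β) (W : Submodule ℚ (ι → ℚ)) : Finset ι :=
  {c | ∃ f ∈ W, f c ≠ 0 ∧ ∀ b, φ b < φ c → f b = 0}

theorem mem_initialPositions {φ : ι → β} {W : Submodule ℚ (ι → ℚ)} {c : ι} :
    c ∈ initialPositions φ W ↔ ∃ f ∈ W, f c ≠ 0 ∧ ∀ b, φ b < φ c → f b = 0 := by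
  simp [initialPositions]

/-- Elements with distinct initial positions are independent; conversely, a nonzero element cannot
vanish at all initial positions, its own included. -/
theorem card_initialPositions {φ : ι → β} (hφ : Function.Injective φ)
    (W : Submodule ℚ (ι → ℚ)) : #(initialPositions φ W) = Module.finrank ℚ W := by
  apply le_antisymm
  · choose f hfW hf0 hfφ using fun c : initialPositions φ W => mem_initialPositions.1 c.2
    have hli : LinearIndependent ℚ (fun c => (⟨f c, hfW c⟩ : W)) := by
      rw [Fintype.linearIndependent_iff]
      intro g hg
      by_contra! hne
      obtain ⟨c, hc, hmin⟩ := exists_min_image {c | g c ≠ 0} (fun c => φ c.1)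
        (by obtain ⟨c, hc⟩ := hne; exact ⟨c, by simpa using hc⟩)
      have hc0 : g c ≠ 0 := by simpa using hc
      have hsum : ∑ c', g c' * f c' c.1 = 0 := by
        have := congrFun (congrArg Subtype.val hg) c.1
        simpa [Submodule.coe_sum, Finset.sum_apply] using this
      rw [sum_eq_single c] at hsum
      · exact mul_ne_zero hc0 (hf0 c) hsum
      · intro c' _ hcc'
        by_cases hg' : g c' = 0
        · rw [hg', zero_mul]
        · have hle := hmin c' (by simpa using hg')
          have hlt : φ c.1 < φ c'.1 := lt_of_le_of_ne hle fun h =>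
            hcc' (Subtype.ext (hφ h)).symm
          rw [hfφ c' _ hlt, mul_zero]
      · simp
    have := hli.fintype_card_le_finrank
    simpa using this
  · have hinj : Function.Injective
        ((LinearMap.funLeft ℚ ℚ (Subtype.val : initialPositions φ W → ι)).comp W.subtype) := by
      rw [← LinearMap.ker_eq_bot, LinearMap.ker_eq_bot']
      intro f hf
      by_contra hne
      have hne' : ∃ c, f.1 c ≠ 0 := by
        by_contra! h
        exact hne (Subtype.ext (funext h))
      obtain ⟨c, hc, hmin⟩ := exists_min_image {c | f.1 c ≠ 0} φ
        (by obtain ⟨c, hc⟩ := hne'; exact ⟨c, by simpa using hc⟩)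
      have hc0 : f.1 c ≠ 0 := by simpa using hc
      have hmem : c ∈ initialPositions φ W := by
        refine mem_initialPositions.2 ⟨f.1, f.2, hc0, fun b hb => ?_⟩
        by_contra hb0
        exact absurd (hmin b (by simpa using hb0)) (not_le.2 hb)
      exact hc0 (congrFun hf ⟨c, hmem⟩)
    have := LinearMap.finrank_le_finrank_of_injective hinj
    simpa using this

end InitialPositions

/-! ### Divisors, the inverse system and its initial monomials. -/

section Multicomplex

open Finset Classical

variable {σ : Type*}

/-- Extension by zero of a function on `S`. -/
noncomputable def extendZero (S : Finset (σ →₀ ℕ)) : (S → ℚ) →ₗ[ℚ] ((σ →₀ ℕ) → ℚ) :=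
  Function.ExtendByZero.linearMap ℚ Subtype.val

theorem extendZero_coe {S : Finset (σ →₀ ℕ)} (v : S → ℚ) (c : S) : extendZero S v c = v c :=
  Subtype.val_injective.extend_apply v 0 c

theorem extendZero_of_notMem {S : Finset (σ →₀ ℕ)} (v : S → ℚ) {c : σ →₀ ℕ} (hc : c ∉ S) :
    extendZero S v c = 0 :=
  Function.extend_apply' v (0 : (σ →₀ ℕ) → ℚ) c (by rintro ⟨a, rfl⟩; exact hc a.2)

theorem sum_ite_eq_extendZero {S : Finset (σ →₀ ℕ)} (v : S → ℚ) (c : σ →₀ ℕ) :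
    ∑ b : S, (if c = b then v b else 0) = extendZero S v c := by
  by_cases hc : c ∈ S
  · rw [sum_eq_single ⟨c, hc⟩]
    · rw [if_pos rfl]
      exact (extendZero_coe v ⟨c, hc⟩).symm
    · intro b _ hb
      rw [if_neg]
      rintro rfl
      exact hb rfl
    · simp
  · rw [extendZero_of_notMem v hc]
    refine sum_eq_zero fun b _ => if_neg ?_
    rintro rfl
    exact hc b.2

variable {ι : Type*} [Finite ι] (m : ι → (σ →₀ ℕ))

theorem finite_divisors (l : ℕ) : {c : σ →₀ ℕ | c.degree = l ∧ ∃ i, c ≤ m i}.Finite := by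
  refine (Set.finite_iUnion fun i => Set.finite_Iic (m i)).subset ?_
  rintro c ⟨-, i, hi⟩
  exact Set.mem_iUnion.2 ⟨i, hi⟩

/-- The monomials of degree `l` that divide some `m i`. -/
noncomputable def divisors (l : ℕ) : Finset (σ →₀ ℕ) := (finite_divisors m l).toFinset

variable {m}

theorem mem_divisors {l : ℕ} {c : σ →₀ ℕ} :
    c ∈ divisors m l ↔ c.degree = l ∧ ∃ i, c ≤ m i := by
  simp [divisors]

theorem isHomogeneousFun_extendZero {l : ℕ} (v : divisors m l → ℚ) :
    IsHomogeneousFun l (extendZero _ v) := by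
  intro c hc
  by_contra h
  exact hc (extendZero_of_notMem v fun h' => h (mem_divisors.1 h').1)

variable [Fintype σ]

/-- The matrix of multiplication by the sum of the variables. -/
noncomputable def raiseMatrix (T S : Finset (σ →₀ ℕ)) : Matrix T S ℚ :=
  fun c b => ∑ s : σ, if c.1 = b.1 + Finsupp.single s 1 then 1 else 0

theorem raiseMatrix_mulVec (T S : Finset (σ →₀ ℕ)) (v : S → ℚ) (c : T) :
    (raiseMatrix T S).mulVec v c = raiseOp (extendZero S v) c := by
  simp only [Matrix.mulVec, dotProduct, raiseMatrix, sum_mul, ite_mul, one_mul, zero_mul]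
  rw [sum_comm, raiseOp_apply]
  refine sum_congr rfl fun s _ => ?_
  split_ifs with h
  · refine sum_eq_zero fun b _ => if_neg fun hb => ?_
    rw [hb] at h
    simp at h
  · rw [← sum_ite_eq_extendZero]
    refine sum_congr rfl fun b _ => if_congr ?_ rfl rfl
    constructor
    · intro hb; rw [hb, add_tsub_cancel_right]
    · intro hb; rw [← hb, sub_single_add_single h]

theorem raiseMatrix_transpose_mulVec (T S : Finset (σ →₀ ℕ)) (f : T → ℚ) (b : S) :
    (raiseMatrix T S).transpose.mulVec f b =
      ∑ s, extendZero T f (b.1 + Finsupp.single s 1) := by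
  simp only [Matrix.mulVec, dotProduct, Matrix.transpose_apply, raiseMatrix, sum_mul, ite_mul,
    one_mul, zero_mul]
  rw [sum_comm]
  refine sum_congr rfl fun s _ => ?_
  rw [← sum_ite_eq_extendZero]
  exact sum_congr rfl fun c _ => if_congr eq_comm rfl rfl

theorem eq_zero_of_raiseOp_pow_vanishes {k : ℕ} (hm : ∀ i, (m i).degree = k) {l p : ℕ}
    (hlp : 2 * l + p ≤ k) (v : divisors m l → ℚ)
    (h : ∀ c ∈ divisors m (l + p), (raiseOp ^ p) (extendZero _ v) c = 0) : v = 0 := by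
  ext c
  obtain ⟨-, i, hi⟩ := mem_divisors.1 c.2
  rw [← extendZero_coe v c, Pi.zero_apply]
  refine vanishes_of_raiseOp_pow_vanishes (m i) l p (by rw [hm]; exact hlp) _
    (isHomogeneousFun_extendZero v) (fun c hc => ?_) c hi
  by_contra hne
  exact hne (h c (mem_divisors.2 ⟨(isHomogeneousFun_extendZero v).raiseOp_pow p c hne, i, hc⟩))

theorem card_divisors_le {k : ℕ} (hm : ∀ i, (m i).degree = k) {l p : ℕ} (hlp : 2 * l + p ≤ k) :
    #(divisors m l) ≤ #(divisors m (l + p)) := by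
  have hinj : Function.Injective
      ((LinearMap.funLeft ℚ ℚ (Subtype.val : divisors m (l + p) → (σ →₀ ℕ))).comp
        ((raiseOp ^ p).comp (extendZero (divisors m l)))) := by
    rw [← LinearMap.ker_eq_bot, LinearMap.ker_eq_bot']
    intro v hv
    exact eq_zero_of_raiseOp_pow_vanishes hm hlp v fun c hc => congrFun hv ⟨c, hc⟩
  simpa using LinearMap.finrank_le_finrank_of_injective hinj

variable (m) in
/-- The degree `l + 1` part of the inverse system of the quotient by the sum of the variables. -/
noncomputable def inverseSystem (l : ℕ) : Submodule ℚ (divisors m (l + 1) → ℚ) :=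
  LinearMap.ker (raiseMatrix (divisors m (l + 1)) (divisors m l)).transpose.mulVecLin

theorem mem_inverseSystem {l : ℕ} {f : divisors m (l + 1) → ℚ} :
    f ∈ inverseSystem m l ↔
      ∀ b ∈ divisors m l, ∑ s, extendZero _ f (b + Finsupp.single s 1) = 0 := by
  rw [inverseSystem, LinearMap.mem_ker, funext_iff]
  simp only [Matrix.mulVecLin_apply, raiseMatrix_transpose_mulVec, Pi.zero_apply, Subtype.forall]

theorem finrank_inverseSystem_add {k : ℕ} (hm : ∀ i, (m i).degree = k) {l : ℕ}
    (hl : 2 * l + 1 ≤ k) :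
    Module.finrank ℚ (inverseSystem m l) + #(divisors m l) = #(divisors m (l + 1)) := by
  have hrank : (raiseMatrix (divisors m (l + 1)) (divisors m l)).rank = #(divisors m l) := by
    rw [Matrix.rank, LinearMap.finrank_range_of_inj]
    · simp
    · rw [← LinearMap.ker_eq_bot, LinearMap.ker_eq_bot']
      intro v hv
      refine eq_zero_of_raiseOp_pow_vanishes hm hl v fun c hc => ?_
      rw [pow_one, ← raiseMatrix_mulVec _ _ v ⟨c, hc⟩]
      exact congrFun hv ⟨c, hc⟩
  have := LinearMap.finrank_range_add_finrank_ker
    (raiseMatrix (divisors m (l + 1)) (divisors m l)).transpose.mulVecLin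
  rw [← Matrix.rank, Matrix.rank_transpose, hrank] at this
  rw [inverseSystem, add_comm, this]
  simp

/-- Contraction by a variable maps the inverse system to itself. -/
theorem contract_mem_inverseSystem {l : ℕ} {f : divisors m (l + 2) → ℚ}
    (hf : f ∈ inverseSystem m (l + 1)) (j : σ) :
    (fun b : divisors m (l + 1) => extendZero _ f (b.1 + Finsupp.single j 1)) ∈
      inverseSystem m l := by
  have hlow : ∀ {c : σ →₀ ℕ} {j : σ} {l : ℕ}, c + Finsupp.single j 1 ∈ divisors m (l + 1) →
      c ∈ divisors m l := by
    intro c j l h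
    obtain ⟨h1, i, hi⟩ := mem_divisors.1 h
    refine mem_divisors.2 ⟨by simpa using h1, i, le_trans ?_ hi⟩
    exact le_self_add
  have hext : ∀ b, extendZero (divisors m (l + 1))
      (fun b => extendZero _ f (b.1 + Finsupp.single j 1)) b =
        extendZero _ f (b + Finsupp.single j 1) := by
    intro b
    by_cases hb : b ∈ divisors m (l + 1)
    · exact extendZero_coe _ ⟨b, hb⟩
    · rw [extendZero_of_notMem _ hb, extendZero_of_notMem]
      exact fun h => hb (hlow h)
  rw [mem_inverseSystem] at hf ⊢
  intro b _
  simp only [hext, add_right_comm b _ (Finsupp.single j 1)]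
  -- If this is not a divisor, neither are its multiples, and every term is zero.
  by_cases hbj : b + Finsupp.single j 1 ∈ divisors m (l + 1)
  · exact hf _ hbj
  · exact sum_eq_zero fun s _ => extendZero_of_notMem _ fun h => hbj (hlow h)

/-- Contraction translates the support by one variable, and the lex order is translation invariant.
-/
theorem sub_single_mem_initialPositions [LinearOrder σ] {l : ℕ} {c : divisors m (l + 2)}
    (hc : c ∈ initialPositions (fun c => toLex c.1) (inverseSystem m (l + 1))) {j : σ}
    (hj : c.1 j ≠ 0) :
    ∃ b ∈ initialPositions (fun c => toLex c.1) (inverseSystem m l),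
      b.1 = c.1 - Finsupp.single j 1 := by
  obtain ⟨f, hf, hfc, hmin⟩ := mem_initialPositions.1 hc
  have hmem : c.1 - Finsupp.single j 1 ∈ divisors m (l + 1) := by
    obtain ⟨h1, i, hi⟩ := mem_divisors.1 c.2
    refine mem_divisors.2 ⟨?_, i, tsub_le_self.trans hi⟩
    have := degree_sub_single_add_one hj
    omega
  refine ⟨⟨_, hmem⟩, mem_initialPositions.2 ⟨_, contract_mem_inverseSystem hf j, ?_, ?_⟩, rfl⟩
  · simpa only [sub_single_add_single hj, extendZero_coe] using hfc
  · intro b hb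
    by_contra hne
    have hbmem : b.1 + Finsupp.single j 1 ∈ divisors m (l + 2) := by
      by_contra h
      exact hne (extendZero_of_notMem _ h)
    refine hne ((extendZero_coe f ⟨_, hbmem⟩).trans (hmin _ ?_))
    have hlt := add_lt_add_left hb (toLex (Finsupp.single j 1))
    simpa only [← toLex_add, sub_single_add_single hj] using hlt

theorem finrank_inverseSystem_succ_le [LinearOrder σ] {l n b : ℕ}
    (h : MacaulayRep (l + 1) n (Module.finrank ℚ (inverseSystem m l)) b) :
    Module.finrank ℚ (inverseSystem m (l + 1)) ≤ b := by
  have hφ : ∀ l, Function.Injective fun c : divisors m l => toLex c.1 :=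
    fun l c c' h => Subtype.ext (toLex.injective h)
  rw [← card_initialPositions (hφ _)] at h ⊢
  rw [← card_map (Function.Embedding.subtype _)]
  refine card_le_of_macaulayRep univ (l + 1) h _
    ((initialPositions (fun c => toLex c.1) (inverseSystem m l)).map
      (Function.Embedding.subtype _)) (fun c hc => ?_) (fun c hc j hj => ?_) (card_map _).le
  · obtain ⟨c, -, rfl⟩ := mem_map.1 hc
    exact ⟨(mem_divisors.1 c.2).1, subset_univ _⟩
  · obtain ⟨c, hc', rfl⟩ := mem_map.1 hc
    obtain ⟨b, hb, hbc⟩ := sub_single_mem_initialPositions hc' hj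
    exact mem_map.2 ⟨b, hb, hbc⟩

end Multicomplex

/-! ### The theorem. -/

theorem theorem3 (k : ℕ) (h : ℕ → ℕ) (hh : IsPureOSequence k h) :
    (∀ i j : ℕ, i ≤ j → i + j ≤ k → h i ≤ h j) ∧ SatisfiesGInequalities k h := by
  obtain ⟨hk, h0, hpos, m, hm, hcount⟩ := hh
  have hcard : ∀ l ≤ k, h l = (divisors m l).card := by
    intro l hl
    rcases Nat.eq_zero_or_pos l with rfl | hl0
    -- In degree 0 the only divisor is 1; `hpos` supplies a monomial for it to divide.
    · rw [h0, eq_comm, Finset.card_eq_one]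
      refine ⟨0, Finset.ext fun c => ?_⟩
      rw [mem_divisors, Finset.mem_singleton, Finsupp.degree_eq_zero_iff]
      exact ⟨fun hc => hc.1, fun hc => ⟨hc, ⟨0, hpos⟩, by simp [hc]⟩⟩
    · rw [hcount l hl0 hl, divisors, Set.ncard_eq_toFinset_card _ (finite_divisors m l)]
  have hmono : ∀ i j : ℕ, i ≤ j → i + j ≤ k → h i ≤ h j := by
    intro i j hij hijk
    obtain ⟨p, rfl⟩ := Nat.exists_eq_add_of_le hij
    have h1 := hcard i (by omega)
    have h2 := hcard (i + p) (by omega)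
    have h3 := card_divisors_le hm (show 2 * i + p ≤ k by omega)
    omega
  have hg : ∀ l, 2 * l + 1 ≤ k →
      gNumber h (l + 1) = Module.finrank ℚ (inverseSystem m l) := by
    intro l hl
    have h1 := hcard l (by omega)
    have h2 := hcard (l + 1) (by omega)
    have h3 := finrank_inverseSystem_add hm hl
    rw [gNumber, Nat.add_sub_cancel]
    omega
  refine ⟨hmono, fun i hi hik => ?_, fun i hi hik r n hn => ?_⟩
  · obtain ⟨i, rfl⟩ := Nat.exists_eq_add_of_le' hi
    rw [hg i (by omega)]
    exact Int.natCast_nonneg _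
  · obtain ⟨i, rfl⟩ := Nat.exists_eq_add_of_le' hi
    have hrep := hn.macaulayRep
    have heq := hn.2.2.2
    rw [hg i (by omega), ← Nat.cast_sum, Nat.cast_inj] at heq
    rw [← heq] at hrep
    rw [hg (i + 1) (by omega)]
    exact_mod_cast finrank_inverseSystem_succ_le hrep
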